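/- Let $U$ be a smooth Riemannian manifold (second countable, possibly with smooth boundary, not necessarily complete), let $m\ge 1$ be an integer and $T\ge 0$. **Notation and definitions.** For a Radon measure $M$ on $U$ and a function $f$ write $Mf=\int f\,dM$. Radon measures $M_i$ converge to $M$ if $M_if\to Mf$ for every continuous compactly supported $f$ on $U$. $\mathcal H^k$ is $k$-dimensional Hausdorff measure for the Riemannian distance. A submanifold of $U$ is *properly embedded* if it is embedded and closed in $U$; its boundary, if any, lies in $\partial U$. Submanifolds $\Gamma_i$ *converge in $C^1$* to $\Gamma$ if near each point of $\Gamma$, for large $i$, $\Gamma_i$ and $\Gamma$ are parametrized over a common domain by $C^1$ embeddings converging uniformly together with their first derivatives, and if each compact set disjoint from $\Gamma$ is disjoint from $\Gamma_i$ for all large $i$. For a properly embedded $(m-1)$-dimensional submanifold $\Gamma$, let $\mathcal V_m(U,\Gamma)$ be the set of Radon measures $M$ on $U$ such that * $M$ is the measure of an $m$-dimensional integral varifold: $M\ll\mathcal H^m$, $M$ is carried by a countable union of $m$-dimensional $C^1$ submanifolds, and its $m$-dimensional density is an integer $M$-almost everywhere; * the varifold has locally bounded first variation; so there are a locally $M$-integrable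 vectorfield $H=H(M,\cdot)$, a Radon measure $\beta=\beta(M)$ singular with respect to $M$, and a Borel vectorfield $\eta$ with $|\eta|=1$ $\beta$-a.e. such that $\int \operatorname{Div}_M X\,dM=-\int H\cdot X\,dM+\int X\cdot\eta\,d\beta$ for all compactly supported $C^1$ vectorfields $X$ on $U$; * $\beta(M)\le\mathcal H^{m-1}\llcorner\Gamma$, and $H(M,x)\perp\operatorname{Tan}(M,x)$ for $M$-almost every $x$. An *$m$-dimensional integral Brakke flow in $U$ on an interval $J$ with boundary $\Gamma$*, where $\Gamma$ is a smooth, properly embedded $(m-1)$-dimensional submanifold of $U$, is a Borel map $t\in J\mapsto M(t)$ into the space of Radon measures on $U$ such that 1. $M(t)\in\mathcal V_m(U,\Gamma)$ for almost every $t\in J$; 2. $\int_a^b\int_K(1+|H|^2)\,dM(t)\,dt<\infty$ for all $[a,b]\subset J$ and all compact $K\subset U$; 3. for all $[a,b]\subset J$ and every nonnegative, compactly supported $C^2$ function $u$ on $U\times[a,b]$, $$M(a)u(\cdot,a)-M(b)u(\cdot,b)\ \ge\ \int_a^b\int\Big(u|H|^2-H\cdot\nabla u-\frac{\partial u}{\partial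 t}\Big)\,dM(t)\,dt,$$ where $H=H(M(t),\cdot)$. **Theorem 6.1.** For $i=1,2,\dots$ let $t\in[0,T]\mapsto M_i(t)$ be an $m$-dimensional integral Brakke flow in $U$ with boundary $\Gamma_i$. Suppose that the $\Gamma_i$ converge in $C^1$ to a smooth, properly embedded $(m-1)$-dimensional submanifold $\Gamma$ of $U$, and that $$c_K:=\sup_i\ \sup_{t\in[0,T]}M_i(t)(K)<\infty$$ for each compact $K\subset U$. Then there are a subsequence $i(j)$, independent of $t$, and Radon measures $M(t)$, $t\in[0,T]$, on $U$ such that, for every $t\in[0,T]$, $M_{i(j)}(t)$ converges to $M(t)$ as $j\to\infty$. -/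

import Mathlib

open scoped Manifold ContDiff Topology ENNReal Bundle
open MeasureTheory Filter Set

noncomputable section

namespace BrakkeFlow

section Submanifolds

variable {E : Type*} [NormedAddCommGroup E] [NormedSpace ℝ E]
  {H : Type*} [TopologicalSpace H] (I : ModelWithCorners ℝ E H)
  {U : Type*} [TopologicalSpace U] [ChartedSpace H U]

/-- Model domain for local parametrizations: the open unit ball of `ℝ^k` if `a = 0`, and an open
unit half ball (containing its flat face) if `a ≠ 0`. -/
def modelBall {k : ℕ} (a : EuclideanSpace ℝ (Fin k) →L[ℝ] ℝ) : Set (EuclideanSpace ℝ (Fin k)) :=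
  {y | ‖y‖ < 1 ∧ 0 ≤ a y}

/-- `F` is a `C^r` embedding of a ball, or of a half ball, of `ℝ^k` onto a relatively open piece of
`S`.  The flat face of a half ball (i.e. the boundary of `S`, if there is any) is
mapped into the boundary of the ambient manifold `U`. -/
structure IsLocalParam (r : ℕ∞) {k : ℕ} (S : Set U) (a : EuclideanSpace ℝ (Fin k) →L[ℝ] ℝ)
    (F : EuclideanSpace ℝ (Fin k) → U) : Prop where
  contMDiffOn : ContMDiffOn 𝓘(ℝ, EuclideanSpace ℝ (Fin k)) I r F (modelBall a)
  immersion : ∀ y ∈ modelBall a, Function.Injective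
    (mfderivWithin 𝓘(ℝ, EuclideanSpace ℝ (Fin k)) I F (modelBall a) y)
  embedding : Topology.IsEmbedding ((modelBall a).domRestrict F)
  image : ∃ O : Set U, IsOpen O ∧ F '' modelBall a = S ∩ O
  boundary : a ≠ 0 → ∀ y ∈ modelBall a, a y = 0 → F y ∈ I.boundary U

/-- `S` is a `k`-dimensional embedded `C^r` submanifold of `U`; it has no boundary in the interior
of `U`. -/
def IsSubmanifold (r : ℕ∞) (k : ℕ) (S : Set U) : Prop :=
  ∀ p ∈ S, ∃ (a : EuclideanSpace ℝ (Fin k) →L[ℝ] ℝ) (F : EuclideanSpace ℝ (Fin k) → U),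
    IsLocalParam I r S a F ∧ F 0 = p

/-- Smooth, properly embedded `k`-dimensional submanifold: the inclusion into `U` is proper, that
is, the submanifold is a closed subset. -/
def IsProperSubmanifold (k : ℕ) (S : Set U) : Prop :=
  IsSubmanifold I (⊤ : ℕ∞) k S ∧ IsClosed S

/-- (Local) `C^1` convergence of `k`-dimensional submanifolds `Γs i` to `Γ`: near each point of `Γ`,
the sets `Γs i` and `Γ` are, for large `i`, parametrized over one domain by `C^1` embeddings that
converge uniformly together with their first derivatives (read in a chart of `U`), and every compact
set disjoint from `Γ` is disjoint from `Γs i` for large `i`. -/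
def C1Converges (k : ℕ) (Γs : ℕ → Set U) (Γ : Set U) : Prop :=
  (∀ p ∈ Γ, ∃ (a : EuclideanSpace ℝ (Fin k) →L[ℝ] ℝ) (F : EuclideanSpace ℝ (Fin k) → U)
      (Fs : ℕ → EuclideanSpace ℝ (Fin k) → U) (O : Set U),
    IsLocalParam I 1 Γ a F ∧ F 0 = p ∧ O ∈ 𝓝 p ∧
    F '' modelBall a ⊆ (chartAt H p).source ∧
    (∀ᶠ i in atTop, IsLocalParam I 1 (Γs i) a (Fs i) ∧
      Fs i '' modelBall a ⊆ (chartAt H p).source ∧ Γs i ∩ O ⊆ Fs i '' modelBall a) ∧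
    TendstoUniformlyOn (fun i y => extChartAt I p (Fs i y)) (fun y => extChartAt I p (F y))
      atTop (modelBall a) ∧
    TendstoUniformlyOn
      (fun i y => fderivWithin ℝ (fun z => extChartAt I p (Fs i z)) (modelBall a) y)
      (fun y => fderivWithin ℝ (fun z => extChartAt I p (F z)) (modelBall a) y)
      atTop (modelBall a)) ∧
  ∀ K : Set U, IsCompact K → Disjoint K Γ → ∀ᶠ i in atTop, Disjoint K (Γs i)

end Submanifolds

section Measures

/-- The `k`-dimensional Hausdorff measure with the geometric normalization, under which it is the
`k`-dimensional volume on `k`-dimensional submanifolds. -/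
def hausdorff (k : ℕ) (U : Type*) [EMetricSpace U] [MeasurableSpace U] [BorelSpace U] :
    Measure U :=
  (volume (Metric.ball (0 : EuclideanSpace ℝ (Fin k)) 1) / 2 ^ k) • Measure.hausdorffMeasure (k : ℝ)

/-- Convergence of Radon measures, tested on continuous compactly supported functions. -/
def RadonTendsto {U : Type*} [TopologicalSpace U] [MeasurableSpace U]
    (Ms : ℕ → Measure U) (M : Measure U) : Prop :=
  ∀ f : U → ℝ, Continuous f → HasCompactSupport f →
    Tendsto (fun i => ∫ x, f x ∂(Ms i)) atTop (𝓝 (∫ x, f x ∂M))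

variable {E : Type*} [NormedAddCommGroup E] [NormedSpace ℝ E]
  {H : Type*} [TopologicalSpace H] (I : ModelWithCorners ℝ E H)
  {U : Type*} [EMetricSpace U] [ChartedSpace H U] [MeasurableSpace U] [BorelSpace U]

/-- `M` is the Radon measure of an `m`-dimensional rectifiable varifold. -/
structure IsRectifiable (m : ℕ) (M : Measure U) : Prop where
  radon : M.Regular
  covered : ∃ S : ℕ → Set U, (∀ j, IsSubmanifold I 1 m (S j)) ∧ M (⋃ j, S j)ᶜ = 0
  absolutelyContinuous : M ≪ hausdorff m U

/-- `M` is the Radon measure of an `m`-dimensional integral varifold: it is rectifiable and at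
`M`-almost every point its `m`-dimensional density exists and is an integer. -/
structure IsIntegral (m : ℕ) (M : Measure U) : Prop where
  rectifiable : IsRectifiable I m M
  density : ∀ᵐ x ∂M, ∃ n : ℕ, Tendsto
    (fun r : ℝ => M (Metric.eball x (ENNReal.ofReal r)) /
      (volume (Metric.ball (0 : EuclideanSpace ℝ (Fin m)) 1) * ENNReal.ofReal r ^ m))
    (𝓝[>] 0) (𝓝 (n : ℝ≥0∞))

/-- The plane field `P` is the (approximate) tangent plane field of the `m`-rectifiable measure
`M`: it agrees with the tangent spaces of every `m`-dimensional `C^1` submanifold `S`, at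
`M`-almost every point of `S`.  It is unique up to `M`-null sets. -/
def IsTangentField (m : ℕ) (M : Measure U) (P : (x : U) → Submodule ℝ (TangentSpace I x)) : Prop :=
  ∀ S : Set U, IsSubmanifold I 1 m S → ∀ᵐ x ∂M, x ∈ S →
    ∀ (a : EuclideanSpace ℝ (Fin m) →L[ℝ] ℝ) (F : EuclideanSpace ℝ (Fin m) → U),
      IsLocalParam I 1 S a F → ∀ y ∈ modelBall a, F y = x →
        P (F y) = LinearMap.range
          (mfderivWithin 𝓘(ℝ, EuclideanSpace ℝ (Fin m)) I F (modelBall a) y).toLinearMap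

open Classical in
/-- `Tan(M, x)`. -/
def tangentPlane (m : ℕ) (M : Measure U) : (x : U) → Submodule ℝ (TangentSpace I x) :=
  if h : ∃ P : (x : U) → Submodule ℝ (TangentSpace I x), IsTangentField I m M P then h.choose
  else fun _ => ⊥

end Measures

section Riemannian

variable {E : Type*} [NormedAddCommGroup E] [NormedSpace ℝ E] [FiniteDimensional ℝ E]
  {H : Type*} [TopologicalSpace H] (I : ModelWithCorners ℝ E H)
  {U : Type*} [EMetricSpace U] [ChartedSpace H U] [IsManifold I ∞ U]
  [Bundle.RiemannianBundle (fun x : U => TangentSpace I x)]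

/-- `⟨∇_v X, v⟩` at `x`, for the Levi-Civita connection `∇`.  By torsion-freeness and metric
compatibility this is `½ X⟨V, V⟩ + ⟨[V, X], V⟩` for any extension `V` of `v` to a vector field;
see `connectionQuadratic_eq`. -/
def connectionQuadratic (X : (x : U) → TangentSpace I x) (x : U) (v : TangentSpace I x) : ℝ :=
  (1 / 2) * mvfderiv I (fun y => inner ℝ (FiberBundle.extend E v y) (FiberBundle.extend E v y)) x
      (X x) +
    inner ℝ (VectorField.mlieBracket I (FiberBundle.extend E v) X x) v

/-- For every torsion-free metric connection on the tangent bundle, `connectionQuadratic` is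
`⟨∇_v X, v⟩`. -/
theorem connectionQuadratic_eq
    (cov : CovariantDerivative I E (TangentSpace I : U → Type _)) (htor : cov.torsion = 0)
    (hmet : ∀ (X Y Z : (x : U) → TangentSpace I x) (x : U),
      MDifferentiableAt I (I.prod 𝓘(ℝ, E)) (fun y => (⟨y, Y y⟩ : TangentBundle I U)) x →
      MDifferentiableAt I (I.prod 𝓘(ℝ, E)) (fun y => (⟨y, Z y⟩ : TangentBundle I U)) x →
      mvfderiv I (fun y => inner ℝ (Y y) (Z y)) x (X x) =
        inner ℝ (cov Y x (X x)) (Z x) + inner ℝ (Y x) (cov Z x (X x)))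
    (X : (x : U) → TangentSpace I x) (x : U) (v : TangentSpace I x)
    (hX : MDifferentiableAt I (I.prod 𝓘(ℝ, E))
      (fun y => (⟨y, X y⟩ : TangentBundle I U)) x) :
    connectionQuadratic I X x v = inner ℝ (cov X x v) v := by
  have hV : MDifferentiableAt I (I.prod 𝓘(ℝ, E))
      (fun y => (⟨y, FiberBundle.extend E v y⟩ : TangentBundle I U)) x :=
    FiberBundle.mdifferentiableAt_extend I E v
  have h1 := hmet X _ _ x hV hV
  have h2 := cov.torsion_eq_zero_iff.1 htor hV hX
  have h3 : FiberBundle.extend E v x = v := FiberBundle.extend_apply_self E v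
  have h4 : inner ℝ (cov X x v - cov (FiberBundle.extend E v) x (X x)) v =
      inner ℝ (cov X x v) v - inner ℝ (cov (FiberBundle.extend E v) x (X x)) v :=
    inner_sub_left (𝕜 := ℝ) _ _ _
  unfold connectionQuadratic
  rw [h1, ← h2, h3, h4, real_inner_comm _ v]
  ring

/-- `Div_P X` at `x`: the trace over the plane `P ⊆ T_x U` of `v ↦ ⟨∇_v X, v⟩`. -/
def divAlong (X : (x : U) → TangentSpace I x) (x : U) (P : Submodule ℝ (TangentSpace I x)) : ℝ :=
  haveI : FiniteDimensional ℝ (TangentSpace I x) := inferInstanceAs (FiniteDimensional ℝ E)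
  ∑ j, connectionQuadratic I X x (stdOrthonormalBasis ℝ P j : TangentSpace I x)

/-- Compactly supported `C^1` vector field. -/
structure IsTestField (X : (x : U) → TangentSpace I x) : Prop where
  contMDiff : ContMDiff I (I.prod 𝓘(ℝ, E)) 1 (fun x => (⟨x, X x⟩ : TangentBundle I U))
  compactSupport : ∃ K : Set U, IsCompact K ∧ ∀ x ∉ K, X x = 0

variable [MeasurableSpace U] [BorelSpace U]

/-- Borel measurable vector field. -/
def IsBorelField (X : (x : U) → TangentSpace I x) : Prop :=
  @Measurable U (TangentBundle I U) _ (borel _) (fun x => ⟨x, X x⟩)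

/-- The first variation `X ↦ ∫ Div_M X dM` of the varifold associated with `M`. -/
def firstVariation (m : ℕ) (M : Measure U) (X : (x : U) → TangentSpace I x) : ℝ :=
  ∫ x, divAlong I X x (tangentPlane I m M x) ∂M

/-- The varifold associated with `M` has (locally) bounded first variation. -/
def HasBoundedFirstVariation (m : ℕ) (M : Measure U) : Prop :=
  ∀ K : Set U, IsCompact K → ∃ C : ℝ, ∀ X : (x : U) → TangentSpace I x, IsTestField I X →
    (∀ x ∉ K, X x = 0) → (∀ x, ‖X x‖ ≤ 1) → |firstVariation I m M X| ≤ C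

/-- `Hv` is a locally `M`-integrable vector field, `β` is a Radon measure singular with respect to
`M`, `η` is a `β`-almost everywhere unit vector field, and
`∫ Div_M X dM = -∫ Hv·X dM + ∫ X·η dβ` for all compactly supported `C^1` vector fields `X`.
Such `Hv`, `β`, `η` are unique up to null sets. -/
structure IsFirstVariation (m : ℕ) (M : Measure U) (Hv : (x : U) → TangentSpace I x)
    (β : Measure U) (η : (x : U) → TangentSpace I x) : Prop where
  borel_Hv : IsBorelField I Hv
  integrable_Hv : ∀ K : Set U, IsCompact K → ∫⁻ x in K, ‖Hv x‖ₑ ∂M < ⊤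
  radon_β : β.Regular
  singular : β ⟂ₘ M
  borel_η : IsBorelField I η
  unit_η : ∀ᵐ x ∂β, ‖η x‖ = 1
  divergence : ∀ X : (x : U) → TangentSpace I x, IsTestField I X →
    firstVariation I m M X = -(∫ x, inner ℝ (Hv x) (X x) ∂M) + ∫ x, inner ℝ (X x) (η x) ∂β

open Classical in
/-- The generalized mean curvature vector field `H(M, ·)` (and `0` if it is not defined). -/
def meanCurvature (m : ℕ) (M : Measure U) : (x : U) → TangentSpace I x :=
  if h : ∃ Hv : (x : U) → TangentSpace I x, ∃ (β : Measure U) (η : (x : U) → TangentSpace I x),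
    IsFirstVariation I m M Hv β η then h.choose else fun _ => 0

/-- The space `𝒱_m(U, Γ)`: integral varifolds of bounded first variation whose singular boundary
measure `β(M)` is at most `ℋ^{m-1} ⌞ Γ` and whose mean curvature is almost everywhere normal. -/
structure IsAdmissible (m : ℕ) (Γ : Set U) (M : Measure U) : Prop where
  integral : IsIntegral I m M
  boundedFirstVariation : HasBoundedFirstVariation I m M
  boundary : ∃ (β : Measure U) (η : (x : U) → TangentSpace I x),
    IsFirstVariation I m M (meanCurvature I m M) β η ∧ β ≤ (hausdorff (m - 1) U).restrict Γ
  perpendicular : ∀ᵐ x ∂M, ∀ v ∈ tangentPlane I m M x, inner ℝ (meanCurvature I m M x) v = 0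

/-- `t ∈ J ↦ M t` is an `m`-dimensional integral Brakke flow in `U` with boundary `Γ`.  In the
defining inequality, `H · ∇u` is written as the differential of `u` applied to `H`. -/
structure IsIntegralBrakkeFlow (m : ℕ) (J : Set ℝ) (Γ : Set U) (M : ℝ → Measure U) : Prop where
  submanifold : IsProperSubmanifold I (m - 1) Γ
  interval : J.OrdConnected
  radon : ∀ t ∈ J, (M t).Regular
  borel : ∀ f : U → ℝ, Continuous f → HasCompactSupport f →
    Measurable (fun t : J => ∫ x, f x ∂(M t))
  admissible : ∀ᵐ t, t ∈ J → IsAdmissible I m Γ (M t)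
  finite : ∀ a b : ℝ, a ≤ b → Icc a b ⊆ J → ∀ K : Set U, IsCompact K →
    ∫⁻ t in Icc a b, ∫⁻ x in K, (1 + ‖meanCurvature I m (M t) x‖ₑ ^ 2) ∂(M t) < ⊤
  inequality : ∀ a b : ℝ, a ≤ b → Icc a b ⊆ J → ∀ u : U → ℝ → ℝ,
    ContMDiffOn (I.prod 𝓘(ℝ, ℝ)) 𝓘(ℝ, ℝ) 2 (fun p : U × ℝ => u p.1 p.2) (univ ×ˢ Icc a b) →
    (∀ x, ∀ t ∈ Icc a b, 0 ≤ u x t) →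
    (∃ K : Set U, IsCompact K ∧ ∀ x ∉ K, ∀ t ∈ Icc a b, u x t = 0) →
    (∫ x, u x a ∂(M a)) - ∫ x, u x b ∂(M b) ≥
      ∫ t in a..b, ∫ x, (u x t * ‖meanCurvature I m (M t) x‖ ^ 2
        - mvfderiv I (fun y => u y t) x (meanCurvature I m (M t) x)
        - derivWithin (fun s => u x s) (Icc a b) t) ∂(M t)

end Riemannian

end BrakkeFlow

end

namespace BrakkeFlow

/-- A countable family of bounded real sequences has a common subsequence along which all of them
converge. -/
theorem exists_strictMono_forall_tendsto {ι : Type*} [Countable ι] (g : ℕ → ι → ℝ) (B : ι → ℝ)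
    (h : ∀ n i, |g n i| ≤ B i) :
    ∃ φ : ℕ → ℕ, StrictMono φ ∧ ∀ i, ∃ l, Tendsto (fun n => g (φ n) i) atTop (𝓝 l) := by
  obtain ⟨a, -, φ, hφ, ha⟩ :=
    (isCompact_univ_pi fun i => isCompact_Icc (a := -B i) (b := B i)).tendsto_subseq (x := g)
      fun n i _ => abs_le.1 (h n i)
  exact ⟨φ, hφ, fun i => ⟨a i, tendsto_pi_nhds.1 ha i⟩⟩

/-- If monotone functions converge at every rational, they converge at every continuity point of
their pointwise upper limit. -/
theorem tendsto_of_continuousAt_limsup {f : ℕ → ℝ → ℝ} (hf : ∀ n, Monotone (f n))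
    (hlim : ∀ q : ℚ, ∃ l, Tendsto (fun n => f n q) atTop (𝓝 l)) {t : ℝ}
    (ht : ContinuousAt (fun s => limsup (fun n => f n s) atTop) t) :
    Tendsto (fun n => f n t) atTop (𝓝 (limsup (fun n => f n t) atTop)) := by
  have hq (q : ℚ) : Tendsto (fun n => f n q) atTop (𝓝 (limsup (fun n => f n q) atTop)) := by
    obtain ⟨l, hl⟩ := hlim q
    rwa [hl.limsup_eq]
  refine tendsto_order.2 ⟨fun a ha => ?_, fun b hb => ?_⟩
  · obtain ⟨l, hl, hl'⟩ := exists_Ioc_subset_of_mem_nhds (ht.eventually_const_lt ha) ⟨t - 1, by simp⟩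
    obtain ⟨q, hlq, hqt⟩ := exists_rat_btwn hl
    filter_upwards [(hq q).eventually_const_lt (hl' ⟨hlq, hqt.le⟩)] with n hn
    exact hn.trans_le (hf n hqt.le)
  · obtain ⟨l, hl, hl'⟩ := exists_Ico_subset_of_mem_nhds (ht.eventually_lt_const hb) ⟨t + 1, by simp⟩
    obtain ⟨q, htq, hql⟩ := exists_rat_btwn hl
    filter_upwards [(hq q).eventually_lt_const (hl' ⟨htq.le, hql⟩)] with n hn
    exact (hf n htq.le).trans_lt hn

/-- **Helly's selection theorem** for countably many sequences of uniformly bounded monotone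
functions. -/
theorem helly_selection {ι : Type*} [Countable ι] (f : ℕ → ι → ℝ → ℝ) (B : ι → ℝ)
    (hmono : ∀ n i, Monotone (f n i)) (hB : ∀ n i t, |f n i t| ≤ B i) :
    ∃ φ : ℕ → ℕ, StrictMono φ ∧ ∀ i t, ∃ l, Tendsto (fun n => f (φ n) i t) atTop (𝓝 l) := by
  obtain ⟨φ, hφ, hφlim⟩ := exists_strictMono_forall_tendsto
    (fun n (p : ι × ℚ) => f n p.1 p.2) (fun p => B p.1) fun n p => hB n p.1 p.2
  let F : ι → ℝ → ℝ := fun i t => limsup (fun n => f (φ n) i t) atTop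
  have hF (i : ι) : Monotone (F i) := fun s t hst => by
    refine limsup_le_limsup (Eventually.of_forall fun n => hmono (φ n) i hst)
      (IsBoundedUnder.isCoboundedUnder_le ⟨-B i, ?_⟩) ⟨B i, ?_⟩
    · exact eventually_map.2 (Eventually.of_forall fun n => (abs_le.1 (hB (φ n) i s)).1)
    · exact eventually_map.2 (Eventually.of_forall fun n => (abs_le.1 (hB (φ n) i t)).2)
  have : ∀ i, Countable {t | ¬ContinuousAt (F i) t} := fun i => (hF i).countable_not_continuousAt
  obtain ⟨ψ, hψ, hψlim⟩ := exists_strictMono_forall_tendsto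
    (fun n (p : Σ i, {t | ¬ContinuousAt (F i) t}) => f (φ n) p.1 p.2) (fun p => B p.1)
    fun n p => hB (φ n) p.1 p.2
  refine ⟨φ ∘ ψ, hφ.comp hψ, fun i t => ?_⟩
  by_cases ht : ContinuousAt (F i) t
  · exact ⟨F i t, (tendsto_of_continuousAt_limsup (fun n => hmono (φ n) i)
      (fun q => hφlim (i, q)) ht).comp hψ.tendsto_atTop⟩
  · exact hψlim ⟨i, t, ht⟩

/-- Helly's selection theorem on `[0, T]` for functions whose increase is at most linear. -/
theorem helly_selection_of_le_add_mul {ι : Type*} [Countable ι] {T : ℝ} (hT : 0 ≤ T)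
    (f : ℕ → ι → ℝ → ℝ) (B L : ι → ℝ)
    (hf : ∀ n i, ∀ a ∈ Icc 0 T, ∀ b ∈ Icc 0 T, a ≤ b → f n i b ≤ f n i a + L i * (b - a))
    (hB : ∀ n i, ∀ t ∈ Icc 0 T, |f n i t| ≤ B i) :
    ∃ φ : ℕ → ℕ, StrictMono φ ∧
      ∀ i, ∀ t ∈ Icc 0 T, ∃ l, Tendsto (fun n => f (φ n) i t) atTop (𝓝 l) := by
  obtain ⟨φ, hφ, h⟩ := helly_selection
    (fun n i t => L i * (projIcc 0 T hT t : ℝ) - f n i (projIcc 0 T hT t))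
    (fun i => |L i| * T + B i)
    (fun n i s t hst => by
      have := hf n i _ (projIcc 0 T hT s).2 _ (projIcc 0 T hT t).2 (monotone_projIcc hT hst)
      dsimp only
      linarith)
    (fun n i t => by
      refine (abs_sub _ _).trans (add_le_add ?_ (hB n i _ (projIcc 0 T hT t).2))
      rw [abs_mul, abs_of_nonneg (projIcc 0 T hT t).2.1]
      exact mul_le_mul_of_nonneg_left (projIcc 0 T hT t).2.2 (abs_nonneg _))
  refine ⟨φ, hφ, fun i t ht => ?_⟩
  obtain ⟨l, hl⟩ := h i t
  simp only [projIcc_of_mem hT ht] at hl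
  exact ⟨L i * t - l, by simpa using hl.const_sub (L i * t)⟩

section Measures

variable {U : Type*} [TopologicalSpace U] [MeasurableSpace U] [BorelSpace U]

/-- A function vanishing off `K` and bounded by `ε` has integral at most `ε * c` if `M K ≤ c`. -/
theorem abs_integral_le_of_support_subset {U : Type*} [MeasurableSpace U] {M : Measure U}
    {K : Set U} {g : U → ℝ} {ε : ℝ} {c : ℝ≥0∞} (hc : c ≠ ⊤) (hMK : M K ≤ c) (hg : ∀ x ∉ K, g x = 0)
    (hε : ∀ x ∈ K, |g x| ≤ ε) (hε0 : 0 ≤ ε) : |∫ x, g x ∂M| ≤ ε * c.toReal := by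
  rw [← setIntegral_eq_integral_of_forall_compl_eq_zero hg]
  refine (norm_setIntegral_le_of_norm_le_const (f := g) (hMK.trans_lt hc.lt_top) hε).trans ?_
  exact mul_le_mul_of_nonneg_left (ENNReal.toReal_mono hc hMK) hε0

variable [T2Space U] [LocallyCompactSpace U]

/-- Radon measures whose integrals of every nonnegative test function converge have a limit. -/
theorem exists_radonTendsto {Ms : ℕ → Measure U} (hMs : ∀ i, (Ms i).Regular)
    (h : ∀ f : U → ℝ, Continuous f → HasCompactSupport f → (∀ x, 0 ≤ f x) →
      ∃ l, Tendsto (fun i => ∫ x, f x ∂(Ms i)) atTop (𝓝 l)) :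
    ∃ M : Measure U, M.Regular ∧ RadonTendsto Ms M := by
  have hint (i : ℕ) (f : CompactlySupportedContinuousMap U ℝ) : Integrable f (Ms i) :=
    f.continuous.integrable_of_hasCompactSupport f.hasCompactSupport
  have hlim (f : CompactlySupportedContinuousMap U ℝ) :
      ∃ l, Tendsto (fun i => ∫ x, f x ∂(Ms i)) atTop (𝓝 l) := by
    have hp : HasCompactSupport fun x => max (f x) 0 :=
      f.hasCompactSupport.comp_left (g := fun y => max y 0) (by simp)
    have hn : HasCompactSupport fun x => max (-f x) 0 :=
      f.hasCompactSupport.comp_left (g := fun y => max (-y) 0) (by simp)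
    have hpc : Continuous fun x => max (f x) 0 := f.continuous.max continuous_const
    have hnc : Continuous fun x => max (-f x) 0 := f.continuous.neg.max continuous_const
    obtain ⟨l₁, h₁⟩ := h _ hpc hp fun x => le_max_right _ _
    obtain ⟨l₂, h₂⟩ := h _ hnc hn fun x => le_max_right _ _
    refine ⟨l₁ - l₂, (h₁.sub h₂).congr fun i => ?_⟩
    rw [← integral_sub (hpc.integrable_of_hasCompactSupport hp)
      (hnc.integrable_of_hasCompactSupport hn)]
    congr 1 with x
    rcases le_total (f x) 0 with hx | hx <;> simp [hx]
  choose l hl using hlim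
  let Λ : CompactlySupportedContinuousMap U ℝ →ₗ[ℝ] ℝ :=
    { toFun := l
      map_add' := fun f g => tendsto_nhds_unique (hl _) <| ((hl f).add (hl g)).congr fun i => by
        rw [← integral_add (hint i f) (hint i g)]; rfl
      map_smul' := fun c f => tendsto_nhds_unique (hl _) <| ((hl f).const_mul c).congr fun i => by
        rw [← integral_const_mul]; rfl }
  let Λp := PositiveLinearMap.mk₀ Λ fun f hf =>
    ge_of_tendsto' (hl f) fun i => integral_nonneg hf
  refine ⟨RealRMK.rieszMeasure Λp, inferInstance, fun f hf hfc => ?_⟩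
  let F : CompactlySupportedContinuousMap U ℝ := ⟨⟨f, hf⟩, hfc⟩
  have := RealRMK.integral_rieszMeasure Λp F
  change ∫ x, f x ∂_ = l F at this
  rw [this]
  exact hl F

variable [SecondCountableTopology U]

/-- Compactness for curves of Radon measures: suppose that the nonnegative test functions can be
approximated by test functions `u ∈ 𝒜` along which the increase of `t ↦ ∫ u dM_i(t)` is at most
linear, uniformly in `i`.  Then a subsequence converges at every time. -/
theorem exists_subseq_radonTendsto {T : ℝ} (hT : 0 ≤ T) (M : ℕ → ℝ → Measure U)
    (hreg : ∀ i, ∀ t ∈ Icc 0 T, (M i t).Regular)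
    (hmass : ∀ K : Set U, IsCompact K → (⨆ i, ⨆ t ∈ Icc 0 T, M i t K) < ⊤)
    (𝒜 : Set C(U, ℝ))
    (hdense : ∀ f : U → ℝ, Continuous f → HasCompactSupport f → (∀ x, 0 ≤ f x) → ∀ ε > 0,
      ∃ u ∈ 𝒜, Function.support u ⊆ Function.support f ∧ ∀ x, |u x - f x| < ε)
    (hdrift : ∀ u ∈ 𝒜, HasCompactSupport u → ∃ L : ℝ, ∀ i, ∀ a ∈ Icc 0 T, ∀ b ∈ Icc 0 T, a ≤ b →
      ∫ x, u x ∂(M i b) ≤ ∫ x, u x ∂(M i a) + L * (b - a)) :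
    ∃ φ : ℕ → ℕ, StrictMono φ ∧ ∃ Mlim : ℝ → Measure U, ∀ t ∈ Icc 0 T,
      (Mlim t).Regular ∧ RadonTendsto (fun j => M (φ j) t) (Mlim t) := by
  have hle {i : ℕ} {t : ℝ} (ht : t ∈ Icc 0 T) (K : Set U) :
      M i t K ≤ ⨆ i, ⨆ t ∈ Icc 0 T, M i t K :=
    (le_iSup₂ (f := fun t (_ : t ∈ Icc 0 T) => M i t K) t ht).trans
      (le_iSup (fun i => ⨆ t ∈ Icc 0 T, M i t K) i)
  let K := CompactExhaustion.choice U
  let 𝒜K : ℕ → Set C(U, ℝ) := fun n => {u ∈ 𝒜 | tsupport u ⊆ K n}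
  choose D hDsub hDc hD using fun n =>
    (TopologicalSpace.IsSeparable.of_separableSpace (𝒜K n)).exists_countable_dense_subset
  have : Countable (⋃ n, D n) := (countable_iUnion hDc).to_subtype
  have hcs (u : ⋃ n, D n) : HasCompactSupport u.1 := by
    obtain ⟨n, hn⟩ := mem_iUnion.1 u.2
    exact (K.isCompact n).of_isClosed_subset (isClosed_tsupport _) (hDsub n hn).2
  choose L hL using fun u : ⋃ n, D n =>
    hdrift u.1 (by obtain ⟨n, hn⟩ := mem_iUnion.1 u.2; exact (hDsub n hn).1) (hcs u)
  choose C hC using fun u : ⋃ n, D n => (hcs u).exists_bound_of_continuous u.1.continuous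
  obtain ⟨φ, hφ, hlim⟩ := helly_selection_of_le_add_mul hT
    (fun n (u : ⋃ n, D n) t => ∫ x, u.1 x ∂(M n t))
    (fun u => |C u| * (⨆ i, ⨆ t ∈ Icc 0 T, M i t (tsupport u.1)).toReal) L
    (fun n u => hL u n)
    (fun n u t ht => abs_integral_le_of_support_subset
      (hmass _ (hcs u)).ne (hle ht _) (fun x hx => image_eq_zero_of_notMem_tsupport hx)
      (fun x _ => (hC u x).trans (le_abs_self _)) (abs_nonneg _))
  have key (t : ℝ) (ht : t ∈ Icc 0 T) : ∃ N : Measure U,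
      N.Regular ∧ RadonTendsto (fun j => M (φ j) t) N := by
    have := fun i => hreg i t ht
    refine exists_radonTendsto (fun j => hreg (φ j) t ht) fun f hf hfc hf0 => ?_
    refine cauchySeq_tendsto_of_complete (Metric.cauchySeq_iff.2 fun ε hε => ?_)
    obtain ⟨n, hn⟩ := K.exists_superset_of_isCompact hfc
    set c := ⨆ i, ⨆ t ∈ Icc 0 T, M i t (K n)
    have hc : c ≠ ⊤ := (hmass _ (K.isCompact n)).ne
    obtain ⟨δ, hδ, hδε⟩ : ∃ δ > 0, δ * c.toReal < ε / 3 := by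
      refine ⟨ε / 3 / (c.toReal + 1), by positivity, ?_⟩
      rw [div_mul_eq_mul_div, div_lt_iff₀ (by positivity)]
      nlinarith
    obtain ⟨u, hu, huf, hclose⟩ := hdense f hf hfc hf0 (δ / 2) (half_pos hδ)
    obtain ⟨v, hv, hvu⟩ : ∃ v ∈ D n, ∀ x ∈ K n, |v x - u x| < δ / 2 := by
      have hu' := hD n ⟨hu, (closure_mono huf).trans hn⟩
      have := (ContinuousMap.tendsto_iff_forall_isCompact_tendstoUniformlyOn.1
        (tendsto_id (x := 𝓝 u))) (K n) (K.isCompact n)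
      obtain ⟨v, hv, hvD⟩ := mem_closure_iff_nhds.1 hu' _
        (Metric.tendstoUniformlyOn_iff.1 this _ (half_pos hδ))
      exact ⟨v, hvD, fun x hx => by simpa [Real.dist_eq, abs_sub_comm] using hv x hx⟩
    have hvc := hcs ⟨v, mem_iUnion.2 ⟨n, hv⟩⟩
    have hvf (j : ℕ) : |∫ x, v x ∂(M (φ j) t) - ∫ x, f x ∂(M (φ j) t)| < ε / 3 := by
      rw [← integral_sub (v.continuous.integrable_of_hasCompactSupport hvc)
        (hf.integrable_of_hasCompactSupport hfc)]
      refine (abs_integral_le_of_support_subset hc (hle ht _) (fun x hx => ?_)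
        (fun x hx => ?_) hδ.le).trans_lt hδε
      · rw [image_eq_zero_of_notMem_tsupport fun h => hx (hn h),
          image_eq_zero_of_notMem_tsupport fun h => hx ((hDsub n hv).2 h), sub_zero]
      · have := abs_sub_le (v x) (u x) (f x)
        linarith [hvu x hx, hclose x]
    obtain ⟨l, hl⟩ := hlim ⟨v, mem_iUnion.2 ⟨n, hv⟩⟩ t ht
    obtain ⟨N, hN⟩ := Metric.cauchySeq_iff.1 hl.cauchySeq (ε / 3) (by positivity)
    refine ⟨N, fun i hi j hj => ?_⟩
    have h1 := hN i hi j hj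
    rw [Real.dist_eq] at h1 ⊢
    have h2 := hvf i
    have h3 := hvf j
    rw [abs_lt] at h1 h2 h3 ⊢
    constructor <;> linarith
  choose! Mlim hMlim using key
  exact ⟨φ, hφ, Mlim, hMlim⟩

end Measures

end BrakkeFlow

namespace BrakkeFlow

section Smooth

variable {E : Type*} [NormedAddCommGroup E] [NormedSpace ℝ E] [FiniteDimensional ℝ E]
  {H : Type*} [TopologicalSpace H] (I : ModelWithCorners ℝ E H)

/-- Nonnegative continuous functions are uniformly approximated by squares of smooth functions with
no larger support. -/
theorem exists_contMDiff_sq_approx {U : Type*} [TopologicalSpace U] [T2Space U]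
    [SigmaCompactSpace U] [ChartedSpace H U] [IsManifold I ∞ U] {f : U → ℝ} (hf : Continuous f)
    (hf0 : ∀ x, 0 ≤ f x) {ε : ℝ} (hε : 0 < ε) :
    ∃ g : U → ℝ, ContMDiff I 𝓘(ℝ, ℝ) ∞ g ∧ Function.support g ⊆ Function.support f ∧
      ∀ x, |g x ^ 2 - f x| < ε := by
  have hs : Continuous fun x => √(f x) := hf.sqrt
  obtain ⟨g, hg, hsupp⟩ := hs.exists_contMDiff_approx I ⊤
    (ε := fun x => ε / (1 + ε + 2 * √(f x)))
    (continuous_const.div (by fun_prop) fun x => by positivity) fun x => by positivity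
  refine ⟨g, g.contMDiff, fun x hx => ?_, fun x => ?_⟩
  · have := hsupp hx
    rw [Function.mem_support] at this ⊢
    exact fun h => this (by simp [h])
  · have h1 := hg x
    have h0 := Real.sqrt_nonneg (f x)
    have h2 := Real.sq_sqrt (hf0 x)
    set s := √(f x)
    rw [Real.dist_eq, lt_div_iff₀ (by positivity)] at h1
    have h3 : |g x - s| * (1 + ε) ≤ ε := by nlinarith [abs_nonneg (g x - s)]
    have h4 : |g x - s| < 1 := by nlinarith
    have h5 : |g x + s| ≤ |g x - s| + 2 * s := by
      calc |g x + s| = |(g x - s) + 2 * s| := by ring_nf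
        _ ≤ |g x - s| + |2 * s| := abs_add_le _ _
        _ = _ := by rw [abs_of_nonneg (by positivity : 0 ≤ 2 * s)]
    calc |g x ^ 2 - f x| = |g x - s| * |g x + s| := by rw [← h2, ← abs_mul]; ring_nf
      _ ≤ |g x - s| * (|g x - s| + 2 * s) := mul_le_mul_of_nonneg_left h5 (abs_nonneg _)
      _ < ε := by nlinarith [abs_nonneg (g x - s)]

variable {U : Type*} [TopologicalSpace U] [ChartedSpace H U] [IsManifold I ∞ U]
  [Bundle.RiemannianBundle (fun x : U => TangentSpace I x)]
  [IsContMDiffRiemannianBundle I ∞ E (fun x : U => TangentSpace I x)]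

attribute [local instance] normedAddCommGroupTangentSpaceVectorSpace
  normedSpaceTangentSpaceVectorSpace

/-- The differential of a smooth function is locally bounded in the Riemannian norm. -/
theorem eventually_abs_mvfderiv_le {g : U → ℝ} (hg : ContMDiff I 𝓘(ℝ, ℝ) ∞ g) (x₀ : U) :
    ∃ C : ℝ, ∀ᶠ x in 𝓝 x₀, ∀ v : TangentSpace I x, |mvfderiv I g x v| ≤ C * ‖v‖ := by
  have : IsManifold I 1 U := .of_le (n := ∞) (by simp)
  have : IsContinuousRiemannianBundle E (fun x : U => TangentSpace I x) := by
    obtain ⟨m, hm, hm'⟩ := IsContMDiffRiemannianBundle.exists_contMDiff (IB := I) (n := ∞) (F := E)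
      (E := fun x : U => TangentSpace I x)
    exact ⟨m, hm.continuous, hm'⟩
  obtain ⟨C₁, hC₁, h₁⟩ := eventually_norm_mfderiv_extChartAt_lt I x₀
  let e := extChartAt I x₀
  let G : E → ℝ := g ∘ e.symm
  have hG : ContDiffOn ℝ ∞ G e.target :=
    contMDiffOn_iff_contDiffOn.1 (hg.comp_contMDiffOn (contMDiffOn_extChartAt_symm x₀))
  have hcont : ContinuousOn (fderivWithin ℝ G e.target) e.target :=
    hG.continuousOn_fderivWithin (uniqueDiffOn_extChartAt_target x₀) (by simp)
  have hcont' : ContinuousAt (fun x => ‖fderivWithin ℝ G e.target (e x)‖) x₀ :=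
    ((hcont.comp (continuousOn_extChartAt x₀) e.mapsTo).norm).continuousAt
      (extChartAt_source_mem_nhds x₀)
  obtain ⟨C₂, hC₂⟩ := exists_gt ‖fderivWithin ℝ G e.target (e x₀)‖
  refine ⟨C₂ * C₁, ?_⟩
  filter_upwards [h₁, hcont'.eventually_lt_const hC₂, extChartAt_source_mem_nhds (I := I) x₀]
    with x hx₁ hx₂ hxs v
  have hxt : e x ∈ e.target := e.map_source hxs
  have hd : HasMFDerivAt I 𝓘(ℝ, ℝ) g x
      ((fderivWithin ℝ G e.target (e x)).comp (mfderiv I 𝓘(ℝ, E) e x)) := by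
    have h1 : HasMFDerivWithinAt 𝓘(ℝ, E) 𝓘(ℝ, ℝ) G e.target (e x)
        (fderivWithin ℝ G e.target (e x)) :=
      ((hG.differentiableOn (by simp)) _ hxt).hasFDerivWithinAt.hasMFDerivWithinAt
    have h2 : HasMFDerivAt I 𝓘(ℝ, E) e x (mfderiv I 𝓘(ℝ, E) e x) :=
      (mdifferentiableAt_extChartAt (by simpa [e] using hxs)).hasMFDerivAt
    have h3 : HasMFDerivAt I 𝓘(ℝ, ℝ) (G ∘ e) x _ :=
      (HasMFDerivWithinAt.comp x h1 h2.hasMFDerivWithinAt e.mapsTo).hasMFDerivAt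
        (extChartAt_source_mem_nhds' hxs)
    refine h3.congr_of_eventuallyEq ?_
    filter_upwards [extChartAt_source_mem_nhds' hxs] with y hy
    simp [G, e.left_inv hy]
  have hmv : mvfderiv I g x v =
      fderivWithin ℝ G e.target (e x) (mfderiv I 𝓘(ℝ, E) e x v) := by
    rw [mvfderiv, hd.mfderiv]; rfl
  rw [hmv]
  calc _ ≤ ‖fderivWithin ℝ G e.target (e x)‖ * ‖mfderiv I 𝓘(ℝ, E) e x v‖ :=
        ContinuousLinearMap.le_opNorm _ _
    _ ≤ C₂ * (C₁ * ‖v‖) := by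
        refine mul_le_mul hx₂.le ?_ (norm_nonneg _) ((norm_nonneg _).trans hx₂.le)
        exact (ContinuousLinearMap.le_opNorm _ _).trans
          (mul_le_mul_of_nonneg_right hx₁.le (norm_nonneg _))
    _ = _ := by ring

/-- The differential of a smooth function is bounded on compact sets. -/
theorem exists_abs_mvfderiv_le {g : U → ℝ} (hg : ContMDiff I 𝓘(ℝ, ℝ) ∞ g) {K : Set U}
    (hK : IsCompact K) :
    ∃ C : ℝ, ∀ x ∈ K, ∀ v : TangentSpace I x, |mvfderiv I g x v| ≤ C * ‖v‖ := by
  refine hK.induction_on (p := fun s => ∃ C : ℝ, ∀ x ∈ s, ∀ v : TangentSpace I x,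
    |mvfderiv I g x v| ≤ C * ‖v‖) ⟨0, by simp⟩ (fun s t hst ⟨C, hC⟩ => ⟨C, fun x hx => hC x (hst hx)⟩)
    (fun s t ⟨C, hC⟩ ⟨C', hC'⟩ => ⟨max C C', fun x hx v => ?_⟩) fun x _ => ?_
  · rcases hx with hx | hx
    · exact (hC x hx v).trans (by gcongr; exact le_max_left _ _)
    · exact (hC' x hx v).trans (by gcongr; exact le_max_right _ _)
  · obtain ⟨C, hC⟩ := eventually_abs_mvfderiv_le I hg x
    exact ⟨_, mem_nhdsWithin_of_mem_nhds hC, C, fun y hy => hy⟩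

end Smooth

section Flow

variable {E : Type*} [NormedAddCommGroup E] [NormedSpace ℝ E] [FiniteDimensional ℝ E]
  {H : Type*} [TopologicalSpace H] {I : ModelWithCorners ℝ E H}
  {U : Type*} [EMetricSpace U] [ChartedSpace H U] [IsManifold I ∞ U]
  [Bundle.RiemannianBundle (fun x : U => TangentSpace I x)]
  [MeasurableSpace U] [BorelSpace U]

/-- Along a Brakke flow, the integral of the square of a smooth compactly supported function
increases at most linearly, with a rate that only depends on the function and on a mass bound: completing the square bounds the
integrand in the Brakke inequality from below by `-C ^ 2` on the support of the function. -/
theorem IsIntegralBrakkeFlow.integral_sq_le {m : ℕ} {J : Set ℝ} {Γ : Set U} {M : ℝ → Measure U}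
    (hM : IsIntegralBrakkeFlow I m J Γ M) {g : U → ℝ} (hg : ContMDiff I 𝓘(ℝ, ℝ) ∞ g)
    (hgc : HasCompactSupport g) {C : ℝ}
    (hC : ∀ x ∈ tsupport g, ∀ v : TangentSpace I x, |mvfderiv I g x v| ≤ C * ‖v‖)
    {c : ℝ≥0∞} (hc : c ≠ ⊤) (hMc : ∀ t ∈ J, M t (tsupport g) ≤ c)
    {a b : ℝ} (hab : a ≤ b) (hJ : Icc a b ⊆ J) :
    ∫ x, g x ^ 2 ∂(M b) ≤ ∫ x, g x ^ 2 ∂(M a) + C ^ 2 * c.toReal * (b - a) := by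
  have hineq := hM.inequality a b hab hJ (fun x _ => g x ^ 2)
    (((hg.comp contMDiff_fst).pow 2).of_le (WithTop.coe_le_coe.2 le_top)).contMDiffOn
    (fun x t _ => sq_nonneg _)
    ⟨tsupport g, hgc, fun x hx t _ => by simp [image_eq_zero_of_notMem_tsupport hx]⟩
  have hder (x : U) (v : TangentSpace I x) :
      mvfderiv I (fun y => g y ^ 2) x v = 2 * g x * mvfderiv I g x v := by
    have hd : MDifferentiableAt I 𝓘(ℝ, ℝ) g x := hg.mdifferentiableAt (by simp)
    simp only [pow_two]
    rw [mvfderiv_fun_mul hd hd]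
    simp only [add_apply, smul_apply, smul_eq_mul]
    ring
  have hpt (t x) : (tsupport g).indicator (fun _ => -C ^ 2) x ≤
      g x ^ 2 * ‖meanCurvature I m (M t) x‖ ^ 2
        - mvfderiv I (fun y => g y ^ 2) x (meanCurvature I m (M t) x)
        - derivWithin (fun _ => g x ^ 2) (Icc a b) t := by
    rw [hder, derivWithin_fun_const]
    by_cases hx : x ∈ tsupport g
    · have h := hC x hx (meanCurvature I m (M t) x)
      rw [indicator_of_mem hx]
      set h₁ := ‖meanCurvature I m (M t) x‖
      set d := mvfderiv I g x (meanCurvature I m (M t) x)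
      have h2 : 2 * (g x * d) ≤ 2 * (|g x| * (C * h₁)) := by
        refine mul_le_mul_of_nonneg_left ((le_abs_self _).trans ?_) zero_le_two
        rw [abs_mul]
        exact mul_le_mul_of_nonneg_left h (abs_nonneg _)
      have h3 : 0 ≤ (|g x| * h₁ - C) ^ 2 := sq_nonneg _
      have h4 := sq_abs (g x)
      simp only [Pi.zero_apply]
      nlinarith
    · simp [indicator_of_notMem hx, image_eq_zero_of_notMem_tsupport hx]
  have hinner (t) (ht : t ∈ Icc a b) : -(C ^ 2 * c.toReal) ≤ ∫ x,
      (g x ^ 2 * ‖meanCurvature I m (M t) x‖ ^ 2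
        - mvfderiv I (fun y => g y ^ 2) x (meanCurvature I m (M t) x)
        - derivWithin (fun _ => g x ^ 2) (Icc a b) t) ∂(M t) := by
    have hmeas : MeasurableSet (tsupport g) := (isClosed_tsupport g).measurableSet
    by_cases hi : Integrable (fun x => g x ^ 2 * ‖meanCurvature I m (M t) x‖ ^ 2
        - mvfderiv I (fun y => g y ^ 2) x (meanCurvature I m (M t) x)
        - derivWithin (fun _ => g x ^ 2) (Icc a b) t) (M t)
    · refine le_trans ?_ (integral_mono ?_ hi (hpt t))
      · rw [integral_indicator hmeas, setIntegral_const, smul_eq_mul, Measure.real]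
        have := ENNReal.toReal_mono hc (hMc t (hJ ht))
        nlinarith [sq_nonneg C]
      · exact (integrable_indicator_iff hmeas).2
          (integrableOn_const ((hMc t (hJ ht)).trans_lt hc.lt_top).ne)
    · rw [integral_undef hi]
      have : 0 ≤ C ^ 2 * c.toReal := by positivity
      linarith
  have houter {F : ℝ → ℝ} {A : ℝ} (hA : 0 ≤ A) (hF : ∀ t ∈ Icc a b, -A ≤ F t) :
      -A * (b - a) ≤ ∫ t in a..b, F t := by
    by_cases hi : IntervalIntegrable F volume a b
    · have := intervalIntegral.integral_mono_on hab intervalIntegrable_const hi hF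
      simpa [mul_comm] using this
    · rw [intervalIntegral.integral_undef hi]
      nlinarith
  have := houter (by positivity) hinner
  linarith

end Flow

end BrakkeFlow

theorem theorem6p1
    {E : Type*} [NormedAddCommGroup E] [NormedSpace ℝ E] [FiniteDimensional ℝ E]
    {H : Type*} [TopologicalSpace H] (I : ModelWithCorners ℝ E H)
    {U : Type*} [EMetricSpace U] [SecondCountableTopology U] [MeasurableSpace U] [BorelSpace U]
    [ChartedSpace H U] [IsManifold I ∞ U]
    [Bundle.RiemannianBundle (fun x : U => TangentSpace I x)]
    [IsContMDiffRiemannianBundle I ∞ E (fun x : U => TangentSpace I x)]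
    [IsRiemannianManifold I U]
    (m : ℕ) (hm : 1 ≤ m) (T : ℝ) (hT : 0 ≤ T)
    (M : ℕ → ℝ → Measure U) (Γs : ℕ → Set U) (Γ : Set U)
    (hflow : ∀ i, BrakkeFlow.IsIntegralBrakkeFlow I m (Set.Icc 0 T) (Γs i) (M i))
    (hΓ : BrakkeFlow.IsProperSubmanifold I (m - 1) Γ)
    (hconv : BrakkeFlow.C1Converges I (m - 1) Γs Γ)
    (hmass : ∀ K : Set U, IsCompact K → (⨆ i, ⨆ t ∈ Set.Icc 0 T, M i t K) < ⊤) :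
    ∃ φ : ℕ → ℕ, StrictMono φ ∧ ∃ Mlim : ℝ → Measure U, ∀ t ∈ Set.Icc 0 T,
      (Mlim t).Regular ∧ BrakkeFlow.RadonTendsto (fun j => M (φ j) t) (Mlim t) := by
  have := Manifold.locallyCompact_of_finiteDimensional (M := U) I
  refine BrakkeFlow.exists_subseq_radonTendsto hT M (fun i => (hflow i).radon) hmass
    {u | ∃ g : U → ℝ, ContMDiff I 𝓘(ℝ, ℝ) ∞ g ∧ ∀ x, u x = g x ^ 2}
    (fun f hf _ hf0 ε hε => ?_) ?_
  · obtain ⟨g, hg, hsupp, happ⟩ := BrakkeFlow.exists_contMDiff_sq_approx I hf hf0 hε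
    refine ⟨⟨fun x => g x ^ 2, hg.continuous.pow 2⟩, ⟨g, hg, fun x => rfl⟩, fun x hx => ?_, happ⟩
    exact hsupp fun h => hx (by simp [h])
  · rintro u ⟨g, hg, hu⟩ huc
    have hgc : HasCompactSupport g := huc.mono fun x hx => by
      rw [Function.mem_support] at hx ⊢
      rw [hu]
      exact pow_ne_zero 2 hx
    obtain ⟨C, hC⟩ := BrakkeFlow.exists_abs_mvfderiv_le I hg hgc
    refine ⟨C ^ 2 * (⨆ i, ⨆ t ∈ Set.Icc 0 T, M i t (tsupport g)).toReal,
      fun i a ha b hb hab => ?_⟩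
    simp only [hu]
    refine (hflow i).integral_sq_le hg hgc hC (hmass _ hgc).ne (fun t ht => ?_) hab (Set.Icc_subset_Icc ha.1 hb.2)
    exact (le_iSup₂ (f := fun t (_ : t ∈ Set.Icc 0 T) => M i t (tsupport g)) t ht).trans
      (le_iSup (fun i => ⨆ t ∈ Set.Icc 0 T, M i t (tsupport g)) i)
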